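/- For $f\in L^2(\mathbb R)$ (complex-valued) let \[ V_\varphi f(t,\omega)=\int_{\mathbb R} f(x)\,\varphi(x-t)\,e^{-2\pi i x\omega}\,dx,\qquad \varphi(x)=e^{-\pi x^2}, \] be its Gabor transform. A set $\Lambda\subset\mathbb R^2$ is said to do Gabor phase retrieval if, for all $f_1,f_2\in L^2(\mathbb R)$, the equality $|V_\varphi f_1(t,\omega)|=|V_\varphi f_2(t,\omega)|$ for all $(t,\omega)\in\Lambda$ implies that there is a real constant $\alpha$ with $f_1=e^{i\alpha}f_2$ almost everywhere. For a set $\Lambda\subset\mathbb R^2$ with no accumulation points in $\mathbb R^2$, let $n_\Lambda(r)=\#\{\lambda\in\Lambda:\ |\lambda|\le r\}$, where $|\cdot|$ is the Euclidean norm, and define its density \[ L_\Lambda=\limsup_{r\to\infty}\frac{\log n_\Lambda(r)}{\log r}\in[0,+\infty] \] (with $L_\emptyset=0$). **Theorem.** Let $\Lambda\subset\mathbb R^2$ be a set with no accumulation points. If $\Lambda$ does Gabor phase retrieval, then $L_\Lambda\ge 2$. -/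

import Mathlib

open MeasureTheory Filter Topology

noncomputable section

/-- The short time Fourier transform
`V_g f(t, ω) = ∫ f(x) * conj (g(x - t)) * exp(-2πixω) dx`. -/
def stft (g f : ℝ → ℂ) (t ω : ℝ) : ℂ :=
  ∫ x : ℝ, f x * (starRingEnd ℂ) (g (x - t)) *
    Complex.exp (-2 * (Real.pi : ℂ) * Complex.I * (x : ℂ) * (ω : ℂ))

/-- The Gaussian `φ(x) = exp(-πx²)`. -/
def gaussianWindow (x : ℝ) : ℂ :=
  ((Real.exp (-Real.pi * x ^ 2) : ℝ) : ℂ)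

/-- `Λ` does phase retrieval for the window `g`: any two signals in `L²(ℝ)` whose short time
Fourier transforms have the same absolute values on `Λ` agree (as elements of `L²(ℝ)`, that is,
almost everywhere) up to a constant phase. A point `p` of `Λ` is `(t, ω) = (p 0, p 1)`. -/
def DoesPhaseRetrieval (g : ℝ → ℂ) (Λ : Set (EuclideanSpace ℝ (Fin 2))) : Prop :=
  ∀ f₁ f₂ : ℝ → ℂ, MemLp f₁ 2 volume → MemLp f₂ 2 volume →
    (∀ p ∈ Λ, ‖stft g f₁ (p 0) (p 1)‖ = ‖stft g f₂ (p 0) (p 1)‖) →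
    ∃ α : ℝ, ∀ᵐ x : ℝ, f₁ x = Complex.exp (Complex.I * (α : ℂ)) * f₂ x

/-- `Λ` does Gabor phase retrieval: phase retrieval for the Gaussian window. -/
def DoesGaborPhaseRetrieval (Λ : Set (EuclideanSpace ℝ (Fin 2))) : Prop :=
  DoesPhaseRetrieval gaussianWindow Λ

/-- `Λ` has no accumulation points in the plane. -/
def HasNoAccPt (Λ : Set (EuclideanSpace ℝ (Fin 2))) : Prop :=
  ∀ x : EuclideanSpace ℝ (Fin 2), ¬ AccPt x (𝓟 Λ)

/-- The counting function `n_Λ(r) = #(Λ ∩ {|λ| ≤ r})`, with the Euclidean norm. The set is finite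
for every `r` when `Λ` has no accumulation points. -/
def countingFunction (Λ : Set (EuclideanSpace ℝ (Fin 2))) (r : ℝ) : ℕ :=
  (Λ ∩ {x | ‖x‖ ≤ r}).ncard

/-- The density `L_Λ = limsup_{r → ∞} log n_Λ(r) / log r`, as an extended real number (it may be
`+∞`). For nonempty `Λ` the logarithms are those of numbers `≥ 1` as soon as `r` is large;
for empty `Λ` the convention is `L_Λ = 0`. -/
def density (Λ : Set (EuclideanSpace ℝ (Fin 2))) : EReal :=
  limsup (fun r : ℝ => ((Real.log (countingFunction Λ r) / Real.log r : ℝ) : EReal)) atTop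

end

/-! Sets of density below 2 are too sparse to determine even the zero signal. If `density Λ < 2`,
then `∑ |λ|⁻² < ∞` (`summable_inv_norm_sq_of_ncard_le`). Hence the points `t - iω` with `(t, ω) ∈ Λ`
are zeros of an entire `G ≠ 0` with `|G z| ≤ C exp(π|z|²/4)` (`exists_entire_vanishing_on`): a
genus-one canonical product has order-two type at most `∑ |a|⁻²`, and moving finitely many zeros
into a polynomial makes this sum arbitrarily small.

Such a `G` lies well inside the Bargmann-Fock space, so an explicit integral gives `f ∈ L²` whose
Gabor transform is `G(t - iω)` times a factor without zeros (`stft_inverseBargmann`). Thus `V f`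
vanishes on `Λ`, as does the transform of the zero signal. Phase retrieval would force `f = 0`
almost everywhere, hence `G = 0`, a contradiction. -/

/-! ### Genus-one canonical products -/

/-- The Weierstrass primary factor of genus one. -/
noncomputable def primaryFactor (u : ℂ) : ℂ := (1 - u) * Complex.exp u

theorem differentiable_primaryFactor : Differentiable ℂ primaryFactor := by
  unfold primaryFactor; fun_prop

/-- Since `|1 - u|² = 1 + (|u|² - 2 Re u) ≤ exp(|u|² - 2 Re u)`, the linear term cancels against
`|exp u|`. With no constant in front, the bounds can be multiplied over infinitely many factors. -/
theorem norm_primaryFactor_le (u : ℂ) : ‖primaryFactor u‖ ≤ Real.exp (‖u‖ ^ 2 / 2) := by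
  have h1 : ‖1 - u‖ ^ 2 = 1 - 2 * u.re + ‖u‖ ^ 2 := by
    rw [Complex.sq_norm, Complex.sq_norm, Complex.normSq_apply, Complex.normSq_apply]
    simp
    ring
  have h2 : ‖1 - u‖ ^ 2 ≤ Real.exp (‖u‖ ^ 2 / 2 - u.re) ^ 2 := by
    rw [h1, ← Real.exp_nat_mul]
    refine le_trans ?_ (Real.add_one_le_exp _)
    push_cast
    linarith
  have h3 := (sq_le_sq₀ (norm_nonneg _) (Real.exp_pos _).le).1 h2
  rw [primaryFactor, norm_mul, Complex.norm_exp]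
  calc _ ≤ Real.exp (‖u‖ ^ 2 / 2 - u.re) * Real.exp u.re := by gcongr
    _ = _ := by rw [← Real.exp_add]; ring_nf

/-- The factor `exp u` removes the linear term of `1 - u`; the quadratic remainder makes `∑ |a|⁻² <
∞` enough for convergence. -/
theorem norm_primaryFactor_sub_one_le {u : ℂ} (hu : ‖u‖ ≤ 1) :
    ‖primaryFactor u - 1‖ ≤ 3 * ‖u‖ ^ 2 := by
  have h := Complex.norm_exp_sub_one_sub_id_le hu
  have e : primaryFactor u - 1 = -u ^ 2 + (1 - u) * (Complex.exp u - 1 - u) := by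
    rw [primaryFactor]; ring
  have h1 : ‖1 - u‖ ≤ 2 := (norm_sub_le _ _).trans (by rw [norm_one]; linarith)
  rw [e]
  calc _ ≤ ‖-u ^ 2‖ + ‖1 - u‖ * ‖Complex.exp u - 1 - u‖ := by
        rw [← norm_mul]; exact norm_add_le _ _
    _ ≤ ‖u‖ ^ 2 + 2 * ‖u‖ ^ 2 := by rw [norm_neg, norm_pow]; gcongr
    _ = _ := by ring

/-- The canonical product of genus one with zeros `a i`. -/
noncomputable def canonicalProduct {ι : Type*} (a : ι → ℂ) (z : ℂ) : ℂ :=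
  ∏' i, primaryFactor (z / a i)

section CanonicalProduct

variable {ι : Type*} {a : ι → ℂ}

theorem hasProdUniformlyOn_canonicalProduct (hs : Summable fun i => (‖a i‖⁻¹) ^ 2) {K : Set ℂ}
    (hK : IsCompact K) :
    HasProdUniformlyOn (fun i z => primaryFactor (z / a i)) (canonicalProduct a) K := by
  obtain ⟨R, hR0, hR⟩ : ∃ R : ℝ, 0 < R ∧ ∀ z ∈ K, ‖z‖ ≤ R := by
    obtain ⟨R, hR⟩ := hK.isBounded.exists_norm_le
    exact ⟨max R 1, by positivity, fun z hz => (hR z hz).trans (le_max_left _ _)⟩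
  have key := (hs.mul_left (3 * R ^ 2)).hasProdUniformlyOn_one_add (R := ℂ) (K := K)
    (f := fun i z => primaryFactor (z / a i) - 1) hK ?_ ?_
  · simp only [add_sub_cancel] at key
    exact key
  · have h1 : ∀ᶠ i in cofinite, (‖a i‖⁻¹) ^ 2 < (R⁻¹) ^ 2 :=
      hs.tendsto_cofinite_zero.eventually_lt_const (by positivity)
    filter_upwards [h1] with i hi z hz
    have h2 : ‖a i‖⁻¹ < R⁻¹ := lt_of_pow_lt_pow_left₀ 2 (by positivity) hi
    have h3 : ‖z / a i‖ ≤ R * ‖a i‖⁻¹ := by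
      rw [norm_div, div_eq_mul_inv]; gcongr; exact hR z hz
    have h4 : R * ‖a i‖⁻¹ ≤ 1 := by
      calc _ ≤ R * R⁻¹ := by gcongr
        _ = 1 := mul_inv_cancel₀ hR0.ne'
    calc _ ≤ 3 * ‖z / a i‖ ^ 2 := norm_primaryFactor_sub_one_le (h3.trans h4)
      _ ≤ 3 * (R * ‖a i‖⁻¹) ^ 2 := by gcongr
      _ = _ := by ring
  · intro i
    have := differentiable_primaryFactor.continuous
    exact Continuous.continuousOn (by fun_prop)

theorem hasProd_canonicalProduct (hs : Summable fun i => (‖a i‖⁻¹) ^ 2) (z : ℂ) :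
    HasProd (fun i => primaryFactor (z / a i)) (canonicalProduct a z) :=
  (hasProdUniformlyOn_canonicalProduct hs (isCompact_singleton (x := z))).hasProd rfl

theorem differentiable_canonicalProduct (hs : Summable fun i => (‖a i‖⁻¹) ^ 2) :
    Differentiable ℂ (canonicalProduct a) := by
  have h : HasProdLocallyUniformlyOn (fun i z => primaryFactor (z / a i)) (canonicalProduct a)
      Set.univ := hasProdLocallyUniformlyOn_of_forall_compact isOpen_univ
    fun K _ hK => hasProdUniformlyOn_canonicalProduct hs hK
  rw [← differentiableOn_univ]
  refine h.differentiableOn (.of_forall fun s => ?_) isOpen_univ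
  have := differentiable_primaryFactor
  exact Differentiable.differentiableOn (Differentiable.fun_finsetProd fun i _ => by fun_prop)

theorem canonicalProduct_zero (a : ι → ℂ) : canonicalProduct a 0 = 1 := by
  simp [canonicalProduct, primaryFactor]

theorem canonicalProduct_apply_eq_zero {i : ι} (hi : a i ≠ 0) : canonicalProduct a (a i) = 0 :=
  tprod_of_exists_eq_zero ⟨i, by simp [primaryFactor, div_self hi]⟩

theorem norm_canonicalProduct_le (hs : Summable fun i => (‖a i‖⁻¹) ^ 2) (z : ℂ) :
    ‖canonicalProduct a z‖ ≤ Real.exp ((∑' i, (‖a i‖⁻¹) ^ 2) * ‖z‖ ^ 2) := by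
  refine le_of_tendsto' (hasProd_canonicalProduct hs z).norm fun s => ?_
  calc ∏ i ∈ s, ‖primaryFactor (z / a i)‖ ≤ ∏ i ∈ s, Real.exp ((‖a i‖⁻¹) ^ 2 * ‖z‖ ^ 2) := by
        refine Finset.prod_le_prod (fun _ _ => norm_nonneg _) fun i _ => ?_
        refine (norm_primaryFactor_le _).trans (Real.exp_le_exp.2 ?_)
        rw [norm_div, div_eq_mul_inv ‖z‖, mul_pow]
        nlinarith [mul_nonneg (sq_nonneg ‖z‖) (sq_nonneg (‖a i‖⁻¹))]
    _ = Real.exp ((∑ i ∈ s, (‖a i‖⁻¹) ^ 2) * ‖z‖ ^ 2) := by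
        rw [← Real.exp_sum, Finset.sum_mul]
    _ ≤ _ := by
        gcongr
        exact hs.sum_le_tsum _ fun _ _ => by positivity

end CanonicalProduct

/-! ### Entire functions of small type with prescribed zeros -/

/-- Finitely many zeros cost arbitrarily little type: each linear factor is absorbed by half of the
remaining exponent. -/
theorem norm_prod_sub_le (T : Finset ℂ) {ε : ℝ} (hε : 0 < ε) :
    ∃ C, ∀ z : ℂ, ‖∏ a ∈ T, (z - a)‖ ≤ C * Real.exp (ε * ‖z‖ ^ 2) := by
  induction T using Finset.induction_on generalizing ε with
  | empty => exact ⟨1, fun z => by simpa using by positivity⟩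
  | insert a T ha ih =>
    obtain ⟨C, hC⟩ := ih (half_pos hε)
    refine ⟨(‖a‖ + 1 + 2 / ε) * C, fun z => ?_⟩
    rw [Finset.prod_insert ha, norm_mul]
    have hx : 1 + ε / 2 * ‖z‖ ^ 2 ≤ Real.exp (ε / 2 * ‖z‖ ^ 2) := by
      linarith [Real.add_one_le_exp (ε / 2 * ‖z‖ ^ 2)]
    have h1 : ‖z - a‖ ≤ (‖a‖ + 1 + 2 / ε) * Real.exp (ε / 2 * ‖z‖ ^ 2) := by
      calc ‖z - a‖ ≤ ‖z‖ + ‖a‖ := norm_sub_le _ _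
        _ ≤ (‖a‖ + 1 + 2 / ε) * (1 + ε / 2 * ‖z‖ ^ 2) := by
          have : (2 / ε) * (ε / 2 * ‖z‖ ^ 2) = ‖z‖ ^ 2 := by field_simp
          have h2 : 0 ≤ 2 / ε := by positivity
          have h3 : 0 ≤ ε / 2 * ‖z‖ ^ 2 := by positivity
          nlinarith [sq_nonneg (‖z‖ - 1), norm_nonneg a, mul_nonneg (norm_nonneg a) h3]
        _ ≤ _ := by gcongr
    calc _ ≤ ((‖a‖ + 1 + 2 / ε) * Real.exp (ε / 2 * ‖z‖ ^ 2)) *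
          (C * Real.exp (ε / 2 * ‖z‖ ^ 2)) := by gcongr; exact hC z
      _ = (‖a‖ + 1 + 2 / ε) * C * (Real.exp (ε / 2 * ‖z‖ ^ 2) * Real.exp (ε / 2 * ‖z‖ ^ 2)) := by
          ring
      _ = _ := by rw [← Real.exp_add]; ring_nf

/-- A set of points with `∑ |a|⁻² < ∞` is contained in the zero set of a nonzero entire function
of arbitrarily small type of order two. -/
theorem exists_entire_vanishing_on {S : Set ℂ} (hs : Summable fun a : S => (‖(a : ℂ)‖⁻¹) ^ 2)
    {ε : ℝ} (hε : 0 < ε) :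
    ∃ G : ℂ → ℂ, Differentiable ℂ G ∧ (∃ z, G z ≠ 0) ∧ (∀ a ∈ S, G a = 0) ∧
      ∃ C, ∀ z, ‖G z‖ ≤ C * Real.exp (ε * ‖z‖ ^ 2) := by
  classical
  have hfin : {a : S | (a : ℂ) = 0}.Finite := by
    refine Set.Subsingleton.finite fun a ha b hb => Subtype.ext ?_
    rw [Set.mem_ofPred_eq] at ha hb
    rw [ha, hb]
  -- `T` leaves a tail sum below `ε / 2` and contains a possible zero at the origin, where the
  -- primary factor would be `primaryFactor (z / 0) = 1` and would not vanish.
  obtain ⟨T, hTε, hT0⟩ := (((tendsto_tsum_compl_atTop_zero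
    fun a : S => (‖(a : ℂ)‖⁻¹) ^ 2).eventually_lt_const (half_pos hε)).and
    (eventually_ge_atTop hfin.toFinset)).exists
  let b : {a : S // a ∉ T} → ℂ := fun a => a.1.1
  have hb : Summable fun i => (‖b i‖⁻¹) ^ 2 := hs.subtype (fun a => a ∉ T)
  have hb0 : ∀ i, b i ≠ 0 := fun i hi => i.2 (hT0 (by simpa using hi))
  let P : ℂ → ℂ := fun z => ∏ a ∈ T.image Subtype.val, (z - a)
  have hH := differentiable_canonicalProduct hb
  obtain ⟨C, hC⟩ := norm_prod_sub_le (T.image Subtype.val) (half_pos hε)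
  refine ⟨fun z => P z * canonicalProduct b z, ?_, ?_, fun a ha => ?_, C, fun z => ?_⟩
  · have : Differentiable ℂ P := by
      exact Differentiable.fun_finsetProd fun i _ => by fun_prop
    fun_prop
  · have h1 : ∀ᶠ z in 𝓝[≠] (0 : ℂ), canonicalProduct b z ≠ 0 :=
      nhdsWithin_le_nhds (hH.continuous.continuousAt.eventually_ne
        (by rw [canonicalProduct_zero]; exact one_ne_zero))
    have h2 : ∀ᶠ z in 𝓝[≠] (0 : ℂ), z ∉ T.image Subtype.val :=
      by
      filter_upwards [mem_nhdsWithin_of_mem_nhds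
        (((T.image Subtype.val).erase 0).finite_toSet.isClosed.isOpen_compl.mem_nhds
          (x := (0 : ℂ)) (by simp)), self_mem_nhdsWithin] with z hz hz0 hzT
      exact hz (Finset.mem_erase.2 ⟨hz0, hzT⟩)
    obtain ⟨z, hz1, hz2⟩ := (h1.and h2).exists
    refine ⟨z, mul_ne_zero (Finset.prod_ne_zero_iff.2 fun a ha h => hz2 ?_) hz1⟩
    rwa [sub_eq_zero.1 h]
  · by_cases haT : (⟨a, ha⟩ : S) ∈ T
    · have : P a = 0 := Finset.prod_eq_zero (Finset.mem_image_of_mem _ haT) (sub_self _)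
      simp [this]
    · have : canonicalProduct b a = 0 :=
        canonicalProduct_apply_eq_zero (i := ⟨⟨a, ha⟩, haT⟩) (hb0 _)
      simp [this]
  · rw [norm_mul]
    calc _ ≤ (C * Real.exp (ε / 2 * ‖z‖ ^ 2)) * Real.exp (ε / 2 * ‖z‖ ^ 2) := by
          gcongr
          · exact (norm_nonneg _).trans (hC z)
          · exact hC z
          · refine (norm_canonicalProduct_le hb z).trans ?_
            gcongr
      _ = C * (Real.exp (ε / 2 * ‖z‖ ^ 2) * Real.exp (ε / 2 * ‖z‖ ^ 2)) := by ring
      _ = _ := by rw [← Real.exp_add]; ring_nf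

/-! ### Gaussian mean values and the reproducing formula -/

theorem integral_Ioo_circleMap {H : ℂ → ℂ} (hH : Differentiable ℂ H) (r : ℝ) :
    ∫ θ in Set.Ioo (-Real.pi) Real.pi, H (circleMap 0 r θ) = 2 * Real.pi * H 0 := by
  have h1 : Real.circleAverage H 0 r = H 0 := hH.diffContOnCl.circleAverage
  have hper : Function.Periodic (fun θ => H (circleMap 0 r θ)) (2 * Real.pi) :=
    (periodic_circleMap 0 r).comp H
  have h2 := hper.intervalIntegral_add_eq 0 (-Real.pi)
  rw [Real.circleAverage_def] at h1
  rw [zero_add, show -Real.pi + 2 * Real.pi = Real.pi by ring] at h2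
  rw [h2] at h1
  rw [← integral_Ioc_eq_integral_Ioo,
    ← intervalIntegral.integral_of_le (by linarith [Real.pi_pos]), ← h1, Complex.real_smul]
  push_cast
  have := Complex.ofReal_ne_zero.2 Real.pi_ne_zero
  field_simp

theorem integrable_exp_neg_mul_norm_sq {b : ℝ} (hb : 0 < b) :
    Integrable fun z : ℂ => Real.exp (-b * ‖z‖ ^ 2) := by
  have h := (integrable_exp_neg_mul_sq hb).mul_prod (integrable_exp_neg_mul_sq hb)
  rw [← Measure.volume_eq_prod,
    ← Complex.volume_preserving_equiv_real_prod.integrable_comp_emb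
      Complex.measurableEquivRealProd.measurableEmbedding] at h
  refine h.congr (.of_forall fun z => ?_)
  simp only [Function.comp, Complex.measurableEquivRealProd_apply]
  rw [← Real.exp_add, Complex.sq_norm, Complex.normSq_apply]
  ring_nf

/-- The mean value property with respect to the Gaussian measure on the plane. -/
theorem integral_mul_exp_neg_pi_norm_sq {H : ℂ → ℂ} (hH : Differentiable ℂ H) {a C : ℝ}
    (ha : a < Real.pi) (hC : ∀ z, ‖H z‖ ≤ C * Real.exp (a * ‖z‖ ^ 2)) :
    ∫ z : ℂ, H z * Real.exp (-Real.pi * ‖z‖ ^ 2) = H 0 := by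
  have hHc := hH.continuous
  rw [← Complex.integral_comp_polarCoord_symm, polarCoord_target, Measure.volume_eq_prod,
    setIntegral_prod]
  · have h1 : ∀ r ∈ Set.Ioi (0 : ℝ), ∫ θ in Set.Ioo (-Real.pi) Real.pi,
        (r, θ).1 • (H (Complex.polarCoord.symm (r, θ)) *
          (Real.exp (-Real.pi * ‖Complex.polarCoord.symm (r, θ)‖ ^ 2) : ℂ)) =
        ((r * Real.exp (-Real.pi * r ^ 2) : ℝ) : ℂ) * (2 * Real.pi * H 0) := by
      intro r hr
      rw [← integral_Ioo_circleMap hH r, ← integral_const_mul]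
      congr 1 with θ
      rw [Complex.norm_polarCoord_symm, sq_abs, Complex.polarCoord_symm_apply,
        circleMap_zero, Complex.exp_mul_I, Complex.real_smul]
      push_cast
      ring
    rw [setIntegral_congr_fun measurableSet_Ioi h1, integral_mul_const, integral_complex_ofReal]
    have h2 : ∫ r in Set.Ioi (0 : ℝ), r * Real.exp (-Real.pi * r ^ 2) = (2 * Real.pi)⁻¹ := by
      have := integral_mul_cexp_neg_mul_sq (b := (Real.pi : ℂ)) (by simpa using Real.pi_pos)
      exact_mod_cast this
    rw [h2]
    push_cast
    have := Complex.ofReal_ne_zero.2 Real.pi_ne_zero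
    field_simp
  · have hb : 0 < Real.pi - a := by linarith
    have hI1 : IntegrableOn (fun r : ℝ => C * (r * Real.exp (-(Real.pi - a) * r ^ 2)))
        (Set.Ioi 0) := ((integrable_mul_exp_neg_mul_sq hb).const_mul C).integrableOn
    have hI2 : IntegrableOn (fun _ : ℝ => (1 : ℝ)) (Set.Ioo (-Real.pi) Real.pi) := by
      simp
    have hI := Integrable.mul_prod (μ := volume.restrict (Set.Ioi (0 : ℝ)))
      (ν := volume.restrict (Set.Ioo (-Real.pi) Real.pi)) hI1 hI2
    rw [IntegrableOn, ← Measure.prod_restrict]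
    refine hI.mono' ?_ ?_
    · refine Continuous.aestronglyMeasurable ?_
      simp only [Complex.polarCoord_symm_apply]
      fun_prop
    · rw [Measure.prod_restrict]
      filter_upwards [ae_restrict_mem (measurableSet_Ioi.prod measurableSet_Ioo)] with p hp
      have hp1 : 0 < p.1 := hp.1
      rw [norm_smul, norm_mul, Complex.norm_polarCoord_symm, sq_abs, Complex.norm_real,
        Real.norm_of_nonneg (Real.exp_pos _).le, Real.norm_of_nonneg hp1.le]
      have h3 := hC (Complex.polarCoord.symm p)
      rw [Complex.norm_polarCoord_symm, sq_abs] at h3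
      calc _ ≤ p.1 * (C * Real.exp (a * p.1 ^ 2) * Real.exp (-Real.pi * p.1 ^ 2)) := by gcongr
        _ = C * (p.1 * (Real.exp (a * p.1 ^ 2) * Real.exp (-Real.pi * p.1 ^ 2))) := by ring
        _ = _ := by rw [← Real.exp_add]; ring_nf

/-- The reproducing formula of the Bargmann-Fock space, for functions of small type. -/
theorem integral_mul_exp_conj_mul {G : ℂ → ℂ} (hG : Differentiable ℂ G) {C : ℝ}
    (hC : ∀ z, ‖G z‖ ≤ C * Real.exp (Real.pi / 4 * ‖z‖ ^ 2)) (w : ℂ) :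
    ∫ z : ℂ, G z * Complex.exp (Real.pi * (starRingEnd ℂ) z * w - Real.pi * ‖z‖ ^ 2) = G w := by
  have hpi := Real.pi_pos
  have hC0 : 0 ≤ C := by
    have := (norm_nonneg _).trans (hC 0)
    simpa using this
  -- Substituting `z + w` for `z` turns the kernel into `exp(-π z w̄ - π|z|²)`, so the formula is
  -- the Gaussian mean value property of `H` at 0.
  let H : ℂ → ℂ := fun z => G (z + w) * Complex.exp (-Real.pi * z * (starRingEnd ℂ) w)
  have hH : Differentiable ℂ H := by
    unfold H; fun_prop
  -- Any coefficient of `|z|²` below `π` would do; `3/4` comes from splitting `(3/2)|z||w| ≤ |z|²/2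
  -- + (9/8)|w|²`.
  have key := integral_mul_exp_neg_pi_norm_sq hH (a := 3 / 4 * Real.pi)
    (C := C * Real.exp (3 / 2 * Real.pi * ‖w‖ ^ 2)) (by linarith) fun z => ?_
  · rw [← integral_add_right_eq_self _ w]
    simp only [H, zero_add, mul_zero, zero_mul, Complex.exp_zero, mul_one] at key
    rw [← key]
    congr 1 with z
    push_cast
    rw [mul_assoc (G (z + w)), ← Complex.exp_add]
    congr 2
    rw [← Complex.mul_conj', ← Complex.mul_conj', map_add]
    ring
  · simp only [H, norm_mul, Complex.norm_exp]
    calc _ ≤ (C * Real.exp (Real.pi / 4 * ‖z + w‖ ^ 2)) * Real.exp (Real.pi * ‖z‖ * ‖w‖) := by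
          gcongr
          · exact hC _
          · refine (Complex.re_le_norm _).trans ?_
            simp [abs_of_pos hpi]
      _ = C * Real.exp (Real.pi * (‖z + w‖ ^ 2 / 4 + ‖z‖ * ‖w‖)) := by
          rw [mul_assoc, ← Real.exp_add]; ring_nf
      _ ≤ C * Real.exp (Real.pi * (3 / 2 * ‖w‖ ^ 2 + 3 / 4 * ‖z‖ ^ 2)) := by
          refine mul_le_mul_of_nonneg_left
            (Real.exp_le_exp.2 (mul_le_mul_of_nonneg_left ?_ hpi.le)) hC0
          have h1 : ‖z + w‖ ^ 2 ≤ (‖z‖ + ‖w‖) ^ 2 := by gcongr; exact norm_add_le _ _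
          nlinarith [sq_nonneg (‖z‖ - 3 / 2 * ‖w‖), sq_nonneg ‖w‖]
      _ = _ := by rw [mul_assoc, ← Real.exp_add]; ring_nf

/-! ### The inverse Bargmann transform -/

/-- The integral kernel of the inverse Bargmann transform. -/
noncomputable def bargmannKernel (z : ℂ) (x : ℝ) : ℂ :=
  Complex.exp (-Real.pi / 2 * (starRingEnd ℂ) z ^ 2 - Real.pi * x ^ 2 +
    2 * Real.pi * x * (starRingEnd ℂ) z - Real.pi * ‖z‖ ^ 2)

theorem continuous_bargmannKernel : Continuous fun p : ℂ × ℝ => bargmannKernel p.1 p.2 := by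
  unfold bargmannKernel
  have := Complex.continuous_conj
  fun_prop

/-- The kernel has modulus `exp(-π(x - Re z)² - π|z|²/2)`. After absorbing growth `π/4`, half of the
remaining decay is kept for `z`; the other half, with `(x - Re z)²`, yields decay in `x`, because
`(x - s)² + s²/8 ≥ x²/9`. -/
theorem norm_bargmannKernel_mul_le (z : ℂ) (x : ℝ) :
    ‖bargmannKernel z x‖ * Real.exp (Real.pi / 4 * ‖z‖ ^ 2) ≤
      Real.exp (-(Real.pi / 8) * ‖z‖ ^ 2) * Real.exp (-(Real.pi / 9) * x ^ 2) := by
  have h : (-Real.pi / 2 * (starRingEnd ℂ) z ^ 2 - Real.pi * x ^ 2 +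
      2 * Real.pi * x * (starRingEnd ℂ) z - Real.pi * ‖z‖ ^ 2 : ℂ).re =
      -Real.pi * (x - z.re) ^ 2 - Real.pi / 2 * (z.re ^ 2 + z.im ^ 2) := by
    have h1 : (‖z‖ : ℂ) ^ 2 = ((z.re ^ 2 + z.im ^ 2 : ℝ) : ℂ) := by
      rw [← Complex.ofReal_pow, Complex.sq_norm, Complex.normSq_apply]
      congr 1; ring
    rw [h1]
    simp [pow_two]
    ring
  rw [bargmannKernel, Complex.norm_exp, h, ← Real.exp_add, ← Real.exp_add, Real.exp_le_exp,
    Complex.sq_norm, Complex.normSq_apply]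
  have key : 0 ≤ (x - z.re) ^ 2 + z.re ^ 2 / 8 - x ^ 2 / 9 + z.im ^ 2 / 8 := by
    nlinarith [sq_nonneg (8 * x - 9 * z.re), sq_nonneg z.im]
  nlinarith [mul_nonneg Real.pi_pos.le key]

/-- The inverse Bargmann transform of an entire function, up to a constant factor. -/
noncomputable def inverseBargmann (G : ℂ → ℂ) (x : ℝ) : ℂ :=
  ∫ z : ℂ, G z * bargmannKernel z x

section InverseBargmann

variable {G : ℂ → ℂ} {C : ℝ}

theorem norm_mul_bargmannKernel_le (hC : ∀ z, ‖G z‖ ≤ C * Real.exp (Real.pi / 4 * ‖z‖ ^ 2))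
    (z : ℂ) (x : ℝ) : ‖G z * bargmannKernel z x‖ ≤
      C * (Real.exp (-(Real.pi / 8) * ‖z‖ ^ 2) * Real.exp (-(Real.pi / 9) * x ^ 2)) := by
  have hC0 : 0 ≤ C := by simpa using (norm_nonneg _).trans (hC 0)
  rw [norm_mul]
  calc _ ≤ C * Real.exp (Real.pi / 4 * ‖z‖ ^ 2) * ‖bargmannKernel z x‖ := by gcongr; exact hC z
    _ = C * (‖bargmannKernel z x‖ * Real.exp (Real.pi / 4 * ‖z‖ ^ 2)) := by ring
    _ ≤ _ := mul_le_mul_of_nonneg_left (norm_bargmannKernel_mul_le z x) hC0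

theorem norm_inverseBargmann_le (hC : ∀ z, ‖G z‖ ≤ C * Real.exp (Real.pi / 4 * ‖z‖ ^ 2)) (x : ℝ) :
    ‖inverseBargmann G x‖ ≤
      C * (∫ z : ℂ, Real.exp (-(Real.pi / 8) * ‖z‖ ^ 2)) * Real.exp (-(Real.pi / 9) * x ^ 2) := by
  refine (norm_integral_le_of_norm_le (((integrable_exp_neg_mul_norm_sq
    (by positivity : 0 < Real.pi / 8)).mul_const _).const_mul C)
    (.of_forall fun z => norm_mul_bargmannKernel_le hC z x)).trans_eq ?_
  rw [integral_const_mul, integral_mul_const, mul_assoc]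

theorem memLp_inverseBargmann (hG : Continuous G)
    (hC : ∀ z, ‖G z‖ ≤ C * Real.exp (Real.pi / 4 * ‖z‖ ^ 2)) :
    MemLp (inverseBargmann G) 2 volume := by
  have hmeas : AEStronglyMeasurable (inverseBargmann G) volume := by
    refine AEStronglyMeasurable.integral_prod_right'
      (f := fun p : ℝ × ℂ => G p.2 * bargmannKernel p.2 p.1) ?_
    exact ((hG.comp continuous_snd).mul
      (continuous_bargmannKernel.comp continuous_swap)).aestronglyMeasurable
  have hgauss : MemLp (fun x : ℝ => Real.exp (-(Real.pi / 9) * x ^ 2)) 2 volume := by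
    rw [memLp_two_iff_integrable_sq (by fun_prop)]
    refine (integrable_exp_neg_mul_sq (by positivity : 0 < 2 * (Real.pi / 9))).congr
      (.of_forall fun x => ?_)
    simp only [← Real.exp_nat_mul]
    congr 1
    push_cast
    ring
  refine (hgauss.const_mul (C * ∫ z : ℂ, Real.exp (-(Real.pi / 8) * ‖z‖ ^ 2))).mono' hmeas
    (.of_forall fun x => norm_inverseBargmann_le hC x)

/-- The Gabor transform of the inverse Bargmann transform of `G` recovers `G`. -/
theorem stft_inverseBargmann (hG : Differentiable ℂ G)
    (hC : ∀ z, ‖G z‖ ≤ C * Real.exp (Real.pi / 4 * ‖z‖ ^ 2)) (t ω : ℝ) :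
    stft gaussianWindow (inverseBargmann G) t ω =
      (1 / 2 : ℂ) ^ (1 / 2 : ℂ) *
        Complex.exp (-Real.pi * t ^ 2 + Real.pi / 2 * (t - ω * Complex.I) ^ 2) *
        G (t - ω * Complex.I) := by
  set w : ℂ := t - ω * Complex.I with hw
  let m : ℝ → ℂ := fun x => (starRingEnd ℂ) (gaussianWindow (x - t)) *
    Complex.exp (-2 * (Real.pi : ℂ) * Complex.I * (x : ℂ) * (ω : ℂ))
  have hm_eq : ∀ x, m x = Complex.exp (-Real.pi * x ^ 2 + 2 * Real.pi * w * x -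
      Real.pi * t ^ 2) := by
    intro x
    simp only [m, gaussianWindow, Complex.conj_ofReal]
    push_cast
    rw [← Complex.exp_add, hw]
    congr 1
    ring
  have hm_norm : ∀ x, ‖m x‖ ≤ 1 := by
    intro x
    have h1 : (-2 * (Real.pi : ℂ) * Complex.I * (x : ℂ) * (ω : ℂ)).re = 0 := by simp
    simp only [m, gaussianWindow, Complex.conj_ofReal, norm_mul, Complex.norm_exp, h1,
      Real.exp_zero, mul_one, Complex.norm_real, Real.norm_of_nonneg (Real.exp_pos _).le]
    rw [Real.exp_le_one_iff]
    nlinarith [mul_nonneg Real.pi_pos.le (sq_nonneg (x - t))]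
  have hm_cont : Continuous m := by
    rw [show m = _ from funext hm_eq]
    fun_prop
  have hint : Integrable (fun p : ℝ × ℂ => G p.2 * bargmannKernel p.2 p.1 * m p.1)
      (volume.prod volume) := by
    have hdom := ((integrable_exp_neg_mul_sq (by positivity : 0 < Real.pi / 9)).mul_prod
      (integrable_exp_neg_mul_norm_sq (by positivity : 0 < Real.pi / 8))).const_mul C
    refine hdom.mono' ?_ (.of_forall fun p => ?_)
    · exact (((hG.continuous.comp continuous_snd).mul
        (continuous_bargmannKernel.comp continuous_swap)).mul
        (hm_cont.comp continuous_fst)).aestronglyMeasurable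
    · rw [norm_mul]
      calc _ ≤ ‖G p.2 * bargmannKernel p.2 p.1‖ * 1 := by gcongr; exact hm_norm _
        _ ≤ _ := by
          rw [mul_one, mul_comm (Real.exp _)]
          exact norm_mul_bargmannKernel_le hC _ _
  have hinner : ∀ z : ℂ, ∫ x : ℝ, G z * bargmannKernel z x * m x =
      (1 / 2 : ℂ) ^ (1 / 2 : ℂ) * Complex.exp (-Real.pi * t ^ 2 + Real.pi / 2 * w ^ 2) *
        (G z * Complex.exp (Real.pi * (starRingEnd ℂ) z * w - Real.pi * ‖z‖ ^ 2)) := by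
    intro z
    have hpi := Complex.ofReal_ne_zero.2 Real.pi_ne_zero
    -- Completing the square gives `(π/2)(z̄ + w)²`: its `z̄²` term cancels the one in the kernel,
    -- and its cross term is the reproducing kernel `exp(π z̄ w)`.
    have hg := integral_cexp_quadratic (b := -2 * Real.pi) (by simp [Real.pi_pos])
      (2 * Real.pi * ((starRingEnd ℂ) z + w))
      (-Real.pi / 2 * (starRingEnd ℂ) z ^ 2 - Real.pi * ‖z‖ ^ 2 - Real.pi * t ^ 2)
    have e1 : (Real.pi : ℂ) / -(-2 * Real.pi) = 1 / 2 := by field_simp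
    rw [e1] at hg
    have e2 : ∀ x : ℝ, G z * bargmannKernel z x * m x = G z * Complex.exp
        (-2 * Real.pi * x ^ 2 + 2 * Real.pi * ((starRingEnd ℂ) z + w) * x +
        (-Real.pi / 2 * (starRingEnd ℂ) z ^ 2 - Real.pi * ‖z‖ ^ 2 - Real.pi * t ^ 2)) := by
      intro x
      rw [hm_eq, bargmannKernel, mul_assoc, ← Complex.exp_add]
      congr 2
      ring
    simp_rw [e2]
    rw [integral_const_mul, hg]
    rw [show ∀ a b c d : ℂ, a * b * (c * d) = c * (a * (b * d)) by intros; ring,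
      ← Complex.exp_add]
    congr 4
    field_simp
    ring
  calc stft gaussianWindow (inverseBargmann G) t ω
      = ∫ x : ℝ, ∫ z : ℂ, G z * bargmannKernel z x * m x := by
        unfold stft inverseBargmann
        congr 1 with x
        rw [integral_mul_const, mul_assoc]
    _ = ∫ z : ℂ, ∫ x : ℝ, G z * bargmannKernel z x * m x := integral_integral_swap hint
    _ = _ := by
        simp_rw [hinner]
        rw [integral_const_mul, integral_mul_exp_conj_mul hG hC]

end InverseBargmann

/-! ### From density to summability -/

/-- For large `k` the dyadic shell `2^k ≤ |a| < 2^(k+1)` holds at most `2^((k+1)ρ)` points, so it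
contributes at most `2^ρ (2^ρ/4)^k`, a geometric series as `ρ < 2`. -/
theorem summable_inv_norm_sq_of_ncard_le {E : Type*} [NormedAddCommGroup E] {S : Set E} {ρ : ℝ}
    (hρ : ρ < 2) (hfin : ∀ r : ℝ, (S ∩ {x | ‖x‖ ≤ r}).Finite)
    (hn : ∀ᶠ r : ℝ in atTop, ((S ∩ {x | ‖x‖ ≤ r}).ncard : ℝ) ≤ r ^ ρ) :
    Summable fun a : S => (‖(a : E)‖⁻¹) ^ 2 := by
  -- Shell 0 also collects all points of norm below 1, as `Nat.log 2 0 = 0`; hence the lower bound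
  -- `hge` needs `k ≠ 0`.
  let shell : ℕ → Set S := fun k => {a | Nat.log 2 ⌊‖(a : E)‖⌋₊ = k}
  have hlt : ∀ k, ∀ a ∈ shell k, ‖(a : E)‖ < 2 ^ (k + 1) := by
    intro k a ha
    have h1 := Nat.lt_pow_succ_log_self one_lt_two ⌊‖(a : E)‖⌋₊
    rw [show Nat.log 2 ⌊‖(a : E)‖⌋₊ = k from ha] at h1
    exact_mod_cast Nat.lt_of_floor_lt h1
  have hge : ∀ k, k ≠ 0 → ∀ a ∈ shell k, (2 : ℝ) ^ k ≤ ‖(a : E)‖ := by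
    intro k hk a ha
    have ha' : Nat.log 2 ⌊‖(a : E)‖⌋₊ = k := ha
    have h0 : ⌊‖(a : E)‖⌋₊ ≠ 0 := by
      rintro h
      rw [h, Nat.log_zero_right] at ha'
      exact hk ha'.symm
    have h1 := Nat.pow_log_le_self 2 h0
    rw [ha'] at h1
    exact (by exact_mod_cast h1 : (2 : ℝ) ^ k ≤ ⌊‖(a : E)‖⌋₊).trans (Nat.floor_le (norm_nonneg _))
  have hsub : ∀ k, Subtype.val '' shell k ⊆ S ∩ {x | ‖x‖ ≤ 2 ^ (k + 1)} := by
    rintro k _ ⟨a, ha, rfl⟩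
    exact ⟨a.2, (hlt k a ha).le⟩
  have hshell_fin : ∀ k, (shell k).Finite := fun k =>
    ((hfin _).subset (hsub k)).of_finite_image Subtype.val_injective.injOn
  rw [summable_partition (fun a => by positivity) (s := shell) fun a => ⟨_, rfl, fun _ h => h.symm⟩]
  refine ⟨fun k => ?_, ?_⟩
  · have := (hshell_fin k).to_subtype
    exact Summable.of_finite
  have hq0 : (0 : ℝ) < 2 ^ ρ := by positivity
  have hq : (2 : ℝ) ^ ρ / 4 < 1 := by
    rw [div_lt_one (by norm_num)]
    calc (2 : ℝ) ^ ρ < 2 ^ (2 : ℝ) := Real.rpow_lt_rpow_of_exponent_lt one_lt_two hρ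
      _ = 4 := by norm_num
  have hpow : Tendsto (fun k : ℕ => (2 : ℝ) ^ (k + 1)) atTop atTop :=
    (tendsto_pow_atTop_atTop_of_one_lt one_lt_two).comp (tendsto_add_atTop_nat 1)
  refine Summable.of_norm_bounded_eventually_nat
    ((summable_geometric_of_lt_one (by positivity) hq).mul_left ((2 : ℝ) ^ ρ)) ?_
  filter_upwards [hpow.eventually hn, eventually_ne_atTop 0] with k hk hk0
  have := (hshell_fin k).fintype
  rw [Real.norm_of_nonneg (tsum_nonneg fun _ => by positivity), tsum_fintype]
  have hcard : (Fintype.card (shell k) : ℝ) ≤ ((2 : ℝ) ^ (k + 1)) ^ ρ := by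
    refine le_trans ?_ hk
    rw [← Nat.card_eq_fintype_card, Nat.card_coe_set_eq,
      ← Set.ncard_image_of_injective (shell k) Subtype.val_injective]
    exact_mod_cast Set.ncard_le_ncard (hsub k) (hfin _)
  calc ∑ a : shell k, (‖((a : S) : E)‖⁻¹) ^ 2
      ≤ ∑ _a : shell k, (((2 : ℝ) ^ k)⁻¹) ^ 2 := by
        gcongr with a
        exact hge k hk0 a a.2
    _ = Fintype.card (shell k) * (((2 : ℝ) ^ k)⁻¹) ^ 2 := by simp
    _ ≤ ((2 : ℝ) ^ (k + 1)) ^ ρ * (((2 : ℝ) ^ k)⁻¹) ^ 2 := by gcongr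
    _ = 2 ^ ρ * (2 ^ ρ / 4) ^ k := by
        rw [← Real.rpow_natCast_mul (by norm_num), mul_comm, div_pow, ← Real.rpow_mul_natCast
          (by norm_num), show (4 : ℝ) = 2 ^ 2 by norm_num, ← pow_mul, mul_comm 2 k, pow_mul,
          inv_pow, div_eq_mul_inv, ← mul_assoc, ← Real.rpow_add (by norm_num), mul_comm]
        push_cast
        ring_nf

theorem HasNoAccPt.finite_inter_norm_le {Λ : Set (EuclideanSpace ℝ (Fin 2))} (hΛ : HasNoAccPt Λ)
    (r : ℝ) : (Λ ∩ {x | ‖x‖ ≤ r}).Finite := by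
  by_contra hinf
  have hK : Λ ∩ {x | ‖x‖ ≤ r} ⊆ Metric.closedBall 0 r := fun x hx => by simpa using hx.2
  obtain ⟨x, -, hx⟩ := Set.Infinite.exists_accPt_of_subset_isCompact hinf
    (isCompact_closedBall (0 : EuclideanSpace ℝ (Fin 2)) r) hK
  exact hΛ x (hx.mono (principal_mono.2 Set.inter_subset_left))

theorem eventually_countingFunction_le_rpow {Λ : Set (EuclideanSpace ℝ (Fin 2))} {ρ : ℝ}
    (hρ : density Λ < ρ) : ∀ᶠ r : ℝ in atTop, (countingFunction Λ r : ℝ) ≤ r ^ ρ := by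
  filter_upwards [eventually_lt_of_limsup_lt hρ, eventually_gt_atTop 1] with r hr hr1
  have hr0 : 0 < r := zero_lt_one.trans hr1
  rw [EReal.coe_lt_coe_iff, div_lt_iff₀ (Real.log_pos hr1)] at hr
  -- Logarithms can be compared only for a positive count, so an empty disc is treated apart.
  rcases Nat.eq_zero_or_pos (countingFunction Λ r) with h0 | h0
  · rw [h0, Nat.cast_zero]
    positivity
  · have h1 : (0 : ℝ) < countingFunction Λ r := by exact_mod_cast h0
    rw [← Real.log_le_log_iff h1 (by positivity), Real.log_rpow hr0]
    exact hr.le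

/-! ### The density bound -/

theorem theorem4p1 (Λ : Set (EuclideanSpace ℝ (Fin 2))) (hΛ : HasNoAccPt Λ)
    (hG : DoesGaborPhaseRetrieval Λ) : (2 : EReal) ≤ density Λ := by
  by_contra! hlt
  obtain ⟨ρ, hρ, hρ2⟩ := EReal.lt_iff_exists_real_btwn.1 hlt
  have hρ2' : ρ < 2 := EReal.coe_lt_coe_iff.1 hρ2
  have hsum := summable_inv_norm_sq_of_ncard_le hρ2' hΛ.finite_inter_norm_le
    (eventually_countingFunction_le_rpow hρ)
  let e : EuclideanSpace ℝ (Fin 2) → ℂ := fun p => p 0 - p 1 * Complex.I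
  have he_norm : ∀ p, ‖e p‖ = ‖p‖ := by
    intro p
    rw [EuclideanSpace.norm_eq, ← Real.sqrt_sq (norm_nonneg (e p)), Complex.sq_norm,
      Complex.normSq_apply]
    simp [e, Fin.sum_univ_two]
    ring_nf
  have he_inj : Function.Injective e := by
    intro p q h
    have h0 := congrArg Complex.re h
    have h1 := congrArg Complex.im h
    simp only [e, Complex.sub_re, Complex.sub_im, Complex.mul_re, Complex.mul_im,
      Complex.ofReal_re, Complex.ofReal_im, Complex.I_re, Complex.I_im] at h0 h1
    ext i
    fin_cases i
    · simpa using h0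
    · simpa using h1
  have hsumS : Summable fun a : (e '' Λ : Set ℂ) => (‖(a : ℂ)‖⁻¹) ^ 2 := by
    rw [← (Equiv.Set.image e Λ he_inj).summable_iff]
    refine hsum.congr fun p => ?_
    simp [he_norm]
  obtain ⟨G, hGd, ⟨z, hz⟩, hGS, C, hC⟩ := exists_entire_vanishing_on hsumS
    (by positivity : 0 < Real.pi / 4)
  -- Comparison with the zero signal makes the phase `α` irrelevant.
  obtain ⟨α, hα⟩ := hG (inverseBargmann G) 0 (memLp_inverseBargmann hGd.continuous hC)
    MemLp.zero fun p hp => by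
      have h0 : G (p 0 - p 1 * Complex.I) = 0 := hGS _ ⟨p, hp, rfl⟩
      rw [stft_inverseBargmann hGd hC, h0]
      simp [stft]
  have hf : inverseBargmann G =ᵐ[volume] 0 := by
    filter_upwards [hα] with x hx
    simpa using hx
  -- The minus sign makes `t - iω` equal to `z`, a point where `G` does not vanish.
  have hzero : stft gaussianWindow (inverseBargmann G) z.re (-z.im) = 0 := by
    refine integral_eq_zero_of_ae ?_
    filter_upwards [hf] with x hx
    simp [hx]
  rw [stft_inverseBargmann hGd hC] at hzero
  have hzz : (z.re : ℂ) - ((-z.im : ℝ) : ℂ) * Complex.I = z := by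
    conv_rhs => rw [← Complex.re_add_im z]
    push_cast
    ring
  rw [hzz] at hzero
  simp [Complex.exp_ne_zero, hz, Complex.cpow_eq_zero_iff] at hzero
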